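/- Let $q$ be a prime power, $m,n\ge 1$ integers with $n\le m$, and let $\mathcal C\subseteq\mathbb F_{q^m}^n$ be an $\mathbb F_{q^m}$-linear code of dimension $2$. The (rank) weight of $c=(c_1,\dots,c_n)\in\mathbb F_{q^m}^n$ is $w(c)=\dim_{\mathbb F_q}\langle c_1,\dots,c_n\rangle_{\mathbb F_q}$. Assume that $\mathcal C$ is non-degenerate, i.e. the columns of any generator matrix of $\mathcal C$ are linearly independent over $\mathbb F_q$. Let $M(\mathcal C)$ be the number of codewords of $\mathcal C$ of weight $\min\{m,n\}=n$, and suppose that $n-e$ is the second maximum weight of $\mathcal C$, i.e. the largest weight of a nonzero codeword other than the maximum weight of $\mathcal C$. Then $$q^{2m}-1-(q^m-1)\frac{q^n-1}{q^e-1}\;\le\; M(\mathcal C)\;\le\; q^{2m}-1-(q^m-1)(q^{n-e}+1),$$ and $$n=\left\lfloor \log_q\!\left(q^m+1-\frac{M(\mathcal C)}{q^m-1}\right)\right\rfloor+e .$$ Moreover, if $m=n$, then $e\mid m$. -/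

import Mathlib

/-- The rank weight of `x ∈ Lⁿ` over `K`: the `K`-dimension of the span of its coordinates. -/
noncomputable def rankWeight (K : Type*) {L : Type*} [Field K] [Field L] [Algebra K L] {n : ℕ}
    (x : Fin n → L) : ℕ :=
  Module.finrank K (Submodule.span K (Set.range x))

/-- `G` is a generator matrix of the code `C`: its rows form an `L`-basis of `C`. -/
def IsGeneratorMatrix {L : Type*} [Field L] {n k : ℕ} (C : Submodule L (Fin n → L))
    (G : Matrix (Fin k) (Fin n) L) : Prop :=
  LinearIndependent L G.row ∧ Submodule.span L (Set.range G.row) = C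

/-- A code is non-degenerate over `K` if the columns of any generator matrix are
linearly independent over `K`. -/
def IsNondegenerateCode (K : Type*) {L : Type*} [Field K] [Field L] [Algebra K L] {n : ℕ}
    (C : Submodule L (Fin n → L)) : Prop :=
  ∀ (k : ℕ) (G : Matrix (Fin k) (Fin n) L), IsGeneratorMatrix C G → LinearIndependent K G.col

/-- The set of weights of the nonzero codewords. -/
def codeWeights (K : Type*) {L : Type*} [Field K] [Field L] [Algebra K L] {n : ℕ}
    (C : Submodule L (Fin n → L)) : Set ℕ :=
  {w | ∃ c ∈ C, c ≠ 0 ∧ rankWeight K c = w}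

/-- `w` is the second maximum weight of `C`: the largest weight of a nonzero codeword that is
different from the maximum weight. -/
def IsSecondMaxWeight (K : Type*) {L : Type*} [Field K] [Field L] [Algebra K L] {n : ℕ}
    (C : Submodule L (Fin n → L)) (w : ℕ) : Prop :=
  ∃ wmax, IsGreatest (codeWeights K C) wmax ∧ IsGreatest (codeWeights K C \ {wmax}) w

/-- `M(C)`: the number of codewords of weight `min {m, n}`, where `m = [L : K]`. -/
noncomputable def numMaxWeight (K : Type*) {L : Type*} [Field K] [Field L] [Algebra K L] {n : ℕ}
    (C : Submodule L (Fin n → L)) : ℕ :=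
  {c : Fin n → L | c ∈ C ∧ rankWeight K c = min (Module.finrank K L) n}.ncard

/-!
Let `a, b` be an `L`-basis of the code `C`, write `q = |K|`, and let `φ c : K ^ n → L` be the map
`u ↦ ∑ uᵢ cᵢ`. The weight of a codeword `c` is the rank of `φ c`, and nondegeneracy says that
`u ↦ (φ a u, φ b u)` embeds `K ^ n` in `L ^ 2`. Its image `U` is a linear set of rank `n`: the
`q ^ m + 1` lines of codewords are the points of a projective line, and a codeword has weight `n - w`
when `U` meets the corresponding point in dimension `w`. So `M(C) = (q ^ m - 1) (q ^ m + 1 - N)`,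
where `N` is the number of points meeting `U`, and `e` is the least positive dimension of such a
meet. The theorem thus amounts to `q ^ (n - e) + 1 ≤ N ≤ (q ^ n - 1) / (q ^ e - 1)`, and to `e ∣ m`
for `n = m`.

The upper bound on `N` counts nonzero vectors (`card_points_mul_le`). The same count, with one
nonzero vector per point, shows that some codeword has weight `n`.

For the lower bound (`card_injective_add_card_range_le`) choose `a` not of weight `n` and `b` of
weight `n - e`, and let `R(X, Y) = ∏ u, (X - (φ b u - Y φ a u))`, of total degree `q ^ n`. The
remainder `H` of `X ^ (q ^ m)` modulo `R` has total degree at most `q ^ m`. If `b - y a` has weight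
`n` then `R(X, y)` divides `X ^ (q ^ m) - X`, so `H(X, y) = X`. At `y = 0`, `R` has a multiple root
while `∏ (X - z)`, over the `q ^ (n - e)` elements `z` of the range of `φ b`, divides both `R(X, 0)`
and `X ^ (q ^ m) - X`; this forces `H(X, 0)` to have degree at least `q ^ (n - e)`. Hence some
coefficient of `X ^ j` in `H`, with `j ≥ q ^ (n - e)`, is a nonzero polynomial in `Y` of degree at
most `q ^ m - j` vanishing at every `y` for which `b - y a` has weight `n`.

For `e ∣ m` (`dvd_of_forall_le_finrank_ker`) take instead `a` of weight `n = m`, so that `U` is the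
graph of a `K`-linear `f = ∑ Fⱼ x ^ (q ^ j)`. The polynomial `R` is linearized in `X`, say
`R = ∑ cᵢ(Y) X ^ (q ^ i)`. For `0 < i < e` the coefficient `cᵢ` vanishes on all of `L` and has degree
less than `q ^ m`, so `cᵢ = 0`, while `cₑ ≠ 0`. Since `R` vanishes at `f x - Y x`, the `cᵢ` solve the
circulant system `cₖ Y ^ (q ^ k) = ∑ᵢ F_{k - i} ^ (q ^ i) cᵢ` for `k ≠ 0` in `ZMod m` (with `c₀`
replaced by `c₀ + 1`). In such a system the nonzero entries have distinct degrees, their differences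
being sums of distinct powers of `q`; so nothing cancels and the support is a submonoid of `ZMod m`
(`add_ne_zero_of_circulant_system`). As it contains `e` and no smaller positive residue, `e ∣ m`.
-/

/-! ### Total degree of bivariate polynomials -/

section TotalDegree

open Polynomial

variable {A : Type*} [CommRing A]

/-- A polynomial in `X` over `A[Y]` has total degree at most `d` in `X` and `Y`. Degrees are taken
in `WithBot ℕ`, so that zero coefficients impose no condition. -/
def TotalDegreeLE (P : A[X][X]) (d : ℕ) : Prop :=
  ∀ j, (P.coeff j).degree + (j : WithBot ℕ) ≤ (d : WithBot ℕ)

lemma TotalDegreeLE.sub {P Q : A[X][X]} {d : ℕ} (hP : TotalDegreeLE P d)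
    (hQ : TotalDegreeLE Q d) : TotalDegreeLE (P - Q) d := by
  intro j
  rw [coeff_sub]
  rcases le_total (P.coeff j).degree (Q.coeff j).degree with h | h
  · refine le_trans ?_ (hQ j)
    gcongr
    exact (degree_sub_le _ _).trans (max_le h le_rfl)
  · refine le_trans ?_ (hP j)
    gcongr
    exact (degree_sub_le _ _).trans (max_le le_rfl h)

lemma TotalDegreeLE.mul {P Q : A[X][X]} {d e : ℕ} (hP : TotalDegreeLE P d)
    (hQ : TotalDegreeLE Q e) : TotalDegreeLE (P * Q) (d + e) := by
  intro j
  have key : (P * Q).coeff j ∈ degreeLE A ((d + e - j : ℕ) : WithBot ℕ) ∧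
      (d + e < j → (P * Q).coeff j = 0) := by
    rw [coeff_mul]
    have aux : ∀ x ∈ Finset.HasAntidiagonal.antidiagonal j, P.coeff x.1 * Q.coeff x.2 ≠ 0 →
        (P.coeff x.1 * Q.coeff x.2).natDegree + j ≤ d + e := by
      intro x hx h0
      have h1 : P.coeff x.1 ≠ 0 := fun h => h0 (by rw [h, zero_mul])
      have h2 : Q.coeff x.2 ≠ 0 := fun h => h0 (by rw [h, mul_zero])
      have e1 := hP x.1
      have e2 := hQ x.2
      rw [degree_eq_natDegree h1] at e1
      rw [degree_eq_natDegree h2] at e2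
      have e1' : (P.coeff x.1).natDegree + x.1 ≤ d := by exact_mod_cast e1
      have e2' : (Q.coeff x.2).natDegree + x.2 ≤ e := by exact_mod_cast e2
      have := natDegree_mul_le (p := P.coeff x.1) (q := Q.coeff x.2)
      have := Finset.HasAntidiagonal.mem_antidiagonal.1 hx
      omega
    refine ⟨Submodule.sum_mem _ fun x hx => ?_, fun hj => Finset.sum_eq_zero fun x hx => ?_⟩
    · by_cases h0 : P.coeff x.1 * Q.coeff x.2 = 0
      · rw [h0]; exact Submodule.zero_mem _
      · have := aux x hx h0
        rw [mem_degreeLE]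
        exact degree_le_of_natDegree_le (by omega)
    · by_contra h0
      have := aux x hx h0
      omega
  by_cases hj : d + e < j
  · rw [key.2 hj]; simp
  · have h1 := mem_degreeLE.1 key.1
    calc _ ≤ ((d + e - j : ℕ) : WithBot ℕ) + (j : WithBot ℕ) := by gcongr
      _ = ((d + e : ℕ) : WithBot ℕ) := by
        rw [← WithBot.coe_natCast, ← WithBot.coe_natCast, ← WithBot.coe_natCast,
          ← WithBot.coe_add]
        congr 1
        simp only [Nat.cast_id]
        omega

lemma TotalDegreeLE.X_sub_C {p : A[X]} (hp : p.degree ≤ 1) :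
    TotalDegreeLE (X - C p : A[X][X]) 1 := by
  intro j
  rcases j with _ | _ | j
  · simpa using hp
  · simp only [coeff_sub, coeff_X, coeff_C]
    norm_num
    exact add_le_of_nonpos_left degree_one_le
  · simp [coeff_X]

lemma TotalDegreeLE.one : TotalDegreeLE (1 : A[X][X]) 0 := by
  intro j
  rcases j with _ | j
  · simp
  · simp [coeff_one]

lemma TotalDegreeLE.prod_X_sub_C {ι : Type*} (s : Finset ι) (p : ι → A[X])
    (hp : ∀ i ∈ s, (p i).degree ≤ 1) :
    TotalDegreeLE (∏ i ∈ s, (X - C (p i)) : A[X][X]) s.card := by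
  classical
  induction s using Finset.induction_on with
  | empty => simpa using TotalDegreeLE.one
  | insert i s hi ih =>
    rw [Finset.prod_insert hi, Finset.card_insert_of_notMem hi, add_comm]
    exact (TotalDegreeLE.X_sub_C (hp i (by simp))).mul
      (ih fun j hj => hp j (Finset.mem_insert_of_mem hj))

/-- Division with remainder by a polynomial monic in `X` of degree `N`, and of total degree at
most `N`, does not raise the total degree. -/
lemma TotalDegreeLE.exists_remainder {R : A[X][X]} (hR : R.Monic)
    (h : TotalDegreeLE R R.natDegree) (hN : 0 < R.natDegree) (k : ℕ) :
    ∃ H : A[X][X], R ∣ X ^ k - H ∧ (∀ j, R.natDegree ≤ j → H.coeff j = 0) ∧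
      TotalDegreeLE H k := by
  induction k with
  | zero =>
    refine ⟨1, by simp, fun j hj => ?_, TotalDegreeLE.one⟩
    rw [coeff_one, if_neg (by omega)]
  | succ k ih =>
    obtain ⟨H, h1, h2, h3⟩ := ih
    set N := R.natDegree with hNdef
    refine ⟨H * X - C (H.coeff (N - 1)) * R, ?_, fun j hj => ?_, ?_⟩
    · have : X ^ (k + 1) - (H * X - C (H.coeff (N - 1)) * R)
          = (X ^ k - H) * X + C (H.coeff (N - 1)) * R := by ring
      rw [this]
      exact dvd_add (h1.mul_right _) (dvd_mul_left _ _)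
    · obtain ⟨j, rfl⟩ : ∃ i, j = i + 1 := ⟨j - 1, by omega⟩
      rw [coeff_sub, coeff_mul_X, coeff_C_mul]
      rcases hj.eq_or_lt with hj | hj
      · rw [← hj, hNdef, hR.coeff_natDegree, ← hNdef, hj]
        simp
      · rw [h2 j (by omega), coeff_eq_zero_of_natDegree_lt (p := R) (by omega)]
        simp
    · intro j
      rw [coeff_sub, coeff_C_mul]
      have hb : (H.coeff (N - 1)).degree + ((N - 1 : ℕ) : WithBot ℕ) ≤ k := h3 (N - 1)
      have hc : (R.coeff j).degree + (j : WithBot ℕ) ≤ N := h j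
      have hN1 : ((N : ℕ) : WithBot ℕ) = ((N - 1 : ℕ) : WithBot ℕ) + 1 := by
        exact_mod_cast (by omega : N = N - 1 + 1)
      have t2 : (H.coeff (N - 1) * R.coeff j).degree + (j : WithBot ℕ) ≤ ((k + 1 : ℕ) : WithBot ℕ) := by
        by_cases z1 : H.coeff (N - 1) = 0
        · simp [z1]
        by_cases z2 : R.coeff j = 0
        · simp [z2]
        rw [degree_eq_natDegree z1] at hb
        rw [degree_eq_natDegree z2] at hc
        have hb' : (H.coeff (N - 1)).natDegree + (N - 1) ≤ k := by exact_mod_cast hb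
        have hc' : (R.coeff j).natDegree + j ≤ N := by exact_mod_cast hc
        have hd := natDegree_mul_le (p := H.coeff (N - 1)) (q := R.coeff j)
        have : (H.coeff (N - 1) * R.coeff j).natDegree + j ≤ k + 1 := by omega
        refine le_trans (add_le_add_left degree_le_natDegree _) ?_
        exact_mod_cast this
      have t1 : ((H * X).coeff j).degree + (j : WithBot ℕ) ≤ ((k + 1 : ℕ) : WithBot ℕ) := by
        rcases j with _ | j
        · simp
        · rw [coeff_mul_X]
          push_cast
          rw [← add_assoc]
          gcongr
          exact h3 j
      rcases le_total ((H * X).coeff j).degree (H.coeff (N - 1) * R.coeff j).degree with hle | hle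
      · refine le_trans ?_ t2
        gcongr
        exact (degree_sub_le _ _).trans (max_le hle le_rfl)
      · refine le_trans ?_ t1
        gcongr
        exact (degree_sub_le _ _).trans (max_le le_rfl hle)

end TotalDegree

/-! ### The Rédei polynomial and the bound on directions of weight zero -/

section Redei

open Polynomial

variable {K L V : Type*} [Field K] [Field L] [Algebra K L] [AddCommGroup V] [Module K V]

/-- The Rédei polynomial `∏ u, (X - (β u - Y α u))` of the linear set `{(α u, β u)}`; the inner
variable is `Y`. -/
noncomputable def redei [Fintype V] (α β : V →ₗ[K] L) : L[X][X] :=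
  ∏ u : V, (X - C (C (β u) - X * C (α u)))

lemma redei_monic [Fintype V] (α β : V →ₗ[K] L) : (redei α β).Monic :=
  monic_prod_of_monic _ _ fun _ _ => monic_X_sub_C _

lemma natDegree_redei [Fintype V] (α β : V →ₗ[K] L) :
    (redei α β).natDegree = Fintype.card V := by
  rw [redei, natDegree_prod_of_monic _ _ fun _ _ => monic_X_sub_C _]
  simp only [natDegree_X_sub_C, Finset.sum_const, Finset.card_univ, smul_eq_mul, mul_one]

lemma totalDegreeLE_redei [Fintype V] (α β : V →ₗ[K] L) :
    TotalDegreeLE (redei α β) (Fintype.card V) := by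
  refine TotalDegreeLE.prod_X_sub_C Finset.univ _ fun u _ => ?_
  refine (degree_sub_le _ _).trans (max_le ?_ ?_)
  · exact degree_C_le.trans (by norm_num)
  · rw [mul_comm]
    exact degree_C_mul_X_le _

lemma map_redei [Fintype V] (α β : V →ₗ[K] L) (y : L) :
    (redei α β).map (evalRingHom y) = ∏ u : V, (X - C ((β - y • α) u)) := by
  simp only [redei, Polynomial.map_prod]
  refine Finset.prod_congr rfl fun u _ => ?_
  simp only [Polynomial.map_sub, map_X, map_C, coe_evalRingHom, eval_sub, eval_mul, eval_C, eval_X,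
    LinearMap.sub_apply, LinearMap.smul_apply, smul_eq_mul]

lemma prod_X_sub_C_dvd_of_injOn {ι : Type*} (s : Finset ι) (f : ι → L) (hf : Set.InjOn f s)
    {P : L[X]} (hP : ∀ i ∈ s, P.eval (f i) = 0) : ∏ i ∈ s, (X - C (f i)) ∣ P := by
  refine Finset.prod_dvd_of_coprime (fun i hi j hj hij => ?_) fun i hi => dvd_iff_isRoot.2 (hP i hi)
  exact isCoprime_X_sub_C_of_isUnit_sub (sub_ne_zero.2 fun h => hij (hf hi hj h)).isUnit

/-- The polynomial bound: a direction of weight `w > 0` leaves at most `|L| - |V| / q ^ w`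
directions of weight zero, where `|V| / q ^ w` is the size of the image of `β`. -/
theorem card_injective_add_card_range_le [Fintype V] [Fintype L] (α β : V →ₗ[K] L)
    (hβ : ¬ Function.Injective β) (hβ0 : β ≠ 0) :
    Nat.card {y : L // Function.Injective (β - y • α)} + Nat.card (Set.range β)
      ≤ Nat.card L := by
  classical
  have hV : 1 < Fintype.card V := by
    obtain ⟨u, hu⟩ : ∃ u, β u ≠ 0 := by
      by_contra! h
      exact hβ0 (LinearMap.ext h)
    exact Fintype.one_lt_card_iff.2 ⟨u, 0, fun h => hu (by rw [h, map_zero])⟩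
  obtain ⟨H, hdvd, hdeg, htot⟩ := TotalDegreeLE.exists_remainder (redei_monic α β)
    (by rw [natDegree_redei]; exact totalDegreeLE_redei α β)
    (by rw [natDegree_redei]; omega) (Fintype.card L)
  rw [natDegree_redei] at hdeg
  have hdvd_y : ∀ y : L, ∏ u : V, (X - C ((β - y • α) u)) ∣
      X ^ Fintype.card L - H.map (evalRingHom y) := by
    intro y
    have := Polynomial.map_dvd (evalRingHom y) hdvd
    rwa [map_redei, Polynomial.map_sub, Polynomial.map_pow, Polynomial.map_X] at this
  -- A remainder of `X ^ |L|` modulo a large enough divisor of `X ^ |L| - X` is `X`.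
  have eq_X : ∀ P F : L[X], F ∣ X ^ Fintype.card L - P → F ∣ X ^ Fintype.card L - X →
      F.Monic → (∀ j, F.natDegree ≤ j → P.coeff j = 0) → 1 < F.natDegree → P = X := by
    intro P F h1 h2 hm h3 h4
    have h5 : F ∣ P - X := by
      have := dvd_sub h2 h1
      rwa [sub_sub_sub_cancel_left] at this
    refine sub_eq_zero.1 (eq_zero_of_dvd_of_degree_lt h5 ?_)
    rw [degree_eq_natDegree hm.ne_zero, degree_lt_iff_coeff_zero]
    intro j hj
    rw [coeff_sub, h3 j hj, coeff_X, if_neg (by omega), sub_zero]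
  have frob : ∀ z : L, (X ^ Fintype.card L - X : L[X]).eval z = 0 := fun z => by
    simp [FiniteField.pow_card]
  have hgood : ∀ y : L, Function.Injective (β - y • α) → H.map (evalRingHom y) = X := by
    intro y hy
    have hn : (∏ u : V, (X - C ((β - y • α) u)) : L[X]).natDegree = Fintype.card V := by
      rw [natDegree_prod_of_monic _ _ fun _ _ => monic_X_sub_C _]
      simp only [natDegree_X_sub_C, Finset.sum_const, Finset.card_univ, smul_eq_mul, mul_one]
    refine eq_X _ _ (hdvd_y y) (prod_X_sub_C_dvd_of_injOn _ _ hy.injOn fun u _ => frob _)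
      (monic_prod_of_monic _ _ fun _ _ => monic_X_sub_C _) (fun j hj => ?_) (by rw [hn]; exact hV)
    rw [coeff_map, hdeg j (by rw [← hn]; exact hj), map_zero]
  -- At `Y = 0` the remainder cannot have degree below the size of the image of `β`: it would
  -- be `X`, and the double root of `redei` at `0` would be one of `X ^ |L| - X`.
  obtain ⟨j, hj, hj0⟩ : ∃ j, Nat.card (Set.range β) ≤ j ∧ (H.coeff j).eval 0 ≠ 0 := by
    by_contra! hcon
    have hr : Nat.card (Set.range β) = (Finset.univ.image β).card := by
      rw [← Set.ncard_coe_finset, Finset.coe_image, Finset.coe_univ, Set.image_univ]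
      rfl
    have hn : (∏ z ∈ Finset.univ.image β, (X - C z) : L[X]).natDegree
        = (Finset.univ.image β).card := by
      rw [natDegree_prod_of_monic _ _ fun _ _ => monic_X_sub_C _]
      simp only [natDegree_X_sub_C, Finset.sum_const, smul_eq_mul, mul_one]
    have h0 := hdvd_y 0
    rw [zero_smul, sub_zero] at h0
    have hX : H.map (evalRingHom 0) = X := by
      refine eq_X _ (∏ z ∈ Finset.univ.image β, (X - C z)) (dvd_trans ?_ h0)
        (prod_X_sub_C_dvd_of_injOn _ id (Set.injOn_id _) fun u _ => frob _)
        (monic_prod_of_monic _ _ fun _ _ => monic_X_sub_C _) (fun i hi => ?_) ?_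
      · refine prod_X_sub_C_dvd_of_injOn _ id (Set.injOn_id _) fun z hz => ?_
        obtain ⟨u, -, rfl⟩ := Finset.mem_image.1 hz
        rw [eval_prod]
        exact Finset.prod_eq_zero (Finset.mem_univ u) (by simp)
      · rw [coeff_map]
        exact hcon i (by rw [hr, ← hn]; exact hi)
      · rw [hn, Finset.one_lt_card]
        obtain ⟨u, hu⟩ : ∃ u, β u ≠ 0 := by
          by_contra! h
          exact hβ0 (LinearMap.ext h)
        exact ⟨β u, Finset.mem_image_of_mem _ (Finset.mem_univ _), β 0,
          Finset.mem_image_of_mem _ (Finset.mem_univ _), by simpa using hu⟩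
    rw [hX] at h0
    obtain ⟨k, hk, hk0⟩ : ∃ k, β k = 0 ∧ k ≠ 0 := by
      rw [injective_iff_map_eq_zero] at hβ
      push Not at hβ
      exact hβ
    have h2 : (X ^ 2 : L[X]) ∣ ∏ u : V, (X - C (β u)) := by
      refine dvd_trans ?_ (Finset.prod_dvd_prod_of_subset {k, 0} Finset.univ _
        (Finset.subset_univ _))
      rw [Finset.prod_pair hk0]
      simp [hk, sq]
    have h3 := X_pow_dvd_iff.1 (h2.trans h0) 1 (by norm_num)
    have hL := Fintype.one_lt_card (α := L)
    rw [coeff_sub, coeff_X_pow, coeff_X_one, if_neg (by omega)] at h3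
    norm_num at h3
  have hne : H.coeff j ≠ 0 := fun h => hj0 (by rw [h, eval_zero])
  have hjdeg : (H.coeff j).natDegree + j ≤ Fintype.card L := by
    have := htot j
    rw [degree_eq_natDegree hne] at this
    exact_mod_cast this
  have hone : 1 < Nat.card (Set.range β) := by
    rw [Finite.one_lt_card_iff_nontrivial]
    obtain ⟨u, hu⟩ : ∃ u, β u ≠ 0 := by
      by_contra! h
      exact hβ0 (LinearMap.ext h)
    refine ⟨⟨⟨β u, u, rfl⟩, ⟨β 0, 0, rfl⟩, fun h => hu ?_⟩⟩
    rw [← map_zero β]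
    exact congrArg Subtype.val h
  have hroots : (Finset.univ.filter fun y : L => Function.Injective (β - y • α)).card
      ≤ (H.coeff j).natDegree := by
    refine card_le_degree_of_subset_roots fun y hy => ?_
    rw [mem_roots hne, IsRoot]
    have h1 := congrArg (fun P => P.coeff j) (hgood y (by simpa using hy))
    simp only [coeff_map, coe_evalRingHom] at h1
    rw [h1, coeff_X, if_neg (by omega)]
  rw [Nat.card_eq_fintype_card, Fintype.card_subtype, Nat.card_eq_fintype_card (α := L)]
  omega

end Redei

/-! ### Counting the points of a linear set -/

section Counting

variable {K L V : Type*} [Field K] [Field L] [Algebra K L] [AddCommGroup V] [Module K V]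

/-- The points of a linear set partition the nonzero vectors: if the point `α = 0` and every
point `β = y α` of the linear set contain at least `k` nonzero vectors each, then the number of
points is at most `(|V| - 1) / k`. -/
lemma card_points_mul_le [Fintype V] [Fintype L] (α β : V →ₗ[K] L)
    (hinj : ∀ u, α u = 0 → β u = 0 → u = 0) (k : ℕ)
    (hα : k + 1 ≤ Nat.card (LinearMap.ker α))
    (hβ : ∀ y : L, ¬ Function.Injective (β - y • α) →
      k + 1 ≤ Nat.card (LinearMap.ker (β - y • α))) :
    (Nat.card {y : L // ¬ Function.Injective (β - y • α)} + 1) * k + 1 ≤ Nat.card V := by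
  classical
  let ψ : Option L → V →ₗ[K] L := fun o => o.elim α fun y => β - y • α
  let E : Option L → Finset V := fun o => Finset.univ.filter fun u => ψ o u = 0 ∧ u ≠ 0
  have hE : ∀ o, k + 1 ≤ Nat.card (LinearMap.ker (ψ o)) → k ≤ (E o).card := by
    intro o ho
    have h1 : Nat.card (LinearMap.ker (ψ o)) = (insert 0 (E o)).card := by
      rw [← Set.ncard_coe_finset]
      change Set.ncard (LinearMap.ker (ψ o) : Set V) = _
      congr 1
      ext u
      by_cases hu : u = 0 <;> simp [E, hu]
    rw [h1] at ho
    have := Finset.card_insert_le 0 (E o)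
    omega
  let bad : Finset L := Finset.univ.filter fun y => ¬ Function.Injective (β - y • α)
  have hdisj : (bad.insertNone : Set (Option L)).PairwiseDisjoint E := by
    intro o _ o' _ hne
    refine Finset.disjoint_left.2 fun u hu hu' => ?_
    simp only [E, Finset.mem_filter, Finset.mem_univ, true_and] at hu hu'
    rcases o with _ | y <;> rcases o' with _ | y'
    · exact hne rfl
    · refine hu.2 (hinj u hu.1 ?_)
      have h1 : α u = 0 := hu.1
      simpa [ψ, h1] using hu'.1
    · refine hu.2 (hinj u hu'.1 ?_)
      have h1 : α u = 0 := hu'.1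
      simpa [ψ, h1] using hu.1
    · have h1 : β u - y * α u = 0 := hu.1
      have h2 : β u - y' * α u = 0 := hu'.1
      have h3 : (y' - y) * α u = 0 := by linear_combination h1 - h2
      rcases mul_eq_zero.1 h3 with h | h
      · exact hne (by rw [sub_eq_zero.1 h])
      · exact hu.2 (hinj u h (by simpa [h] using h1))
  have hsum : bad.insertNone.card * k ≤ ∑ o ∈ bad.insertNone, (E o).card := by
    rw [← smul_eq_mul]
    refine Finset.card_nsmul_le_sum _ _ _ fun o ho => hE o ?_
    rcases o with _ | y
    · exact hα
    · exact hβ y (by simpa [bad] using ho)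
  rw [← Finset.card_biUnion hdisj, Finset.card_insertNone] at hsum
  have hle : (bad.insertNone.biUnion E).card + 1 ≤ Fintype.card V := by
    rw [← Finset.card_insert_of_notMem (a := (0 : V)) (by simp [E])]
    exact Finset.card_le_univ _
  rw [Nat.card_eq_fintype_card, Fintype.card_subtype, Nat.card_eq_fintype_card (α := V)]
  change (bad.card + 1) * k + 1 ≤ _
  omega

end Counting

/-! ### Two-dimensional rank-metric codes -/

section Codes

variable {K L : Type*} [Field K] [Field L] [Algebra K L] {n : ℕ}

open Module

lemma rankWeight_eq_finrank_range (c : Fin n → L) :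
    rankWeight K c = finrank K (LinearMap.range (Fintype.linearCombination K c)) := by
  rw [rankWeight, Fintype.range_linearCombination]

lemma rankWeight_add_finrank_ker (c : Fin n → L) :
    rankWeight K c + finrank K (LinearMap.ker (Fintype.linearCombination K c)) = n := by
  rw [rankWeight_eq_finrank_range, LinearMap.finrank_range_add_finrank_ker, finrank_fin_fun]

lemma rankWeight_eq_iff_injective (c : Fin n → L) :
    rankWeight K c = n ↔ Function.Injective (Fintype.linearCombination K c) := by
  have h := rankWeight_add_finrank_ker (K := K) c
  rw [← LinearMap.ker_eq_bot, ← Submodule.finrank_eq_zero (R := K)]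
  omega

lemma linearCombination_smul_left (s : L) (c : Fin n → L) :
    Fintype.linearCombination K (s • c) = s • Fintype.linearCombination K c := by
  ext
  simp [Fintype.linearCombination_apply]

lemma linearCombination_sub_smul_left (a b : Fin n → L) (y : L) :
    Fintype.linearCombination K (b - y • a)
      = Fintype.linearCombination K b - y • Fintype.linearCombination K a := by
  ext
  simp [Fintype.linearCombination_apply]

lemma exists_linearCombination_ne_zero {c : Fin n → L} (hc : c ≠ 0) :
    ∃ u, Fintype.linearCombination K c u ≠ 0 := by
  obtain ⟨i, hi⟩ := Function.ne_iff.1 hc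
  classical
  exact ⟨Pi.single i 1, by simpa using hi⟩

/-- Two nonzero codewords are independent if some `K`-relation holds for the coordinates of one
but not for those of the other. -/
lemma linearIndependent_pair_of_relation {a b : Fin n → L} (ha : a ≠ 0) (u : Fin n → K)
    (hau : Fintype.linearCombination K a u = 0) (hbu : Fintype.linearCombination K b u ≠ 0) :
    LinearIndependent L ![a, b] := by
  rw [LinearIndependent.pair_iff]
  intro s t h
  have ht : t = 0 := by
    have h1 := congrArg (fun c => Fintype.linearCombination K c u) h
    have h2 : s * Fintype.linearCombination K a u + t * Fintype.linearCombination K b u = 0 := by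
      rw [← smul_eq_mul, ← smul_eq_mul, ← LinearMap.smul_apply, ← LinearMap.smul_apply,
        ← linearCombination_smul_left, ← linearCombination_smul_left]
      simpa [Fintype.linearCombination_apply, Finset.sum_add_distrib] using h1
    rw [hau, mul_zero, zero_add] at h2
    exact (mul_eq_zero.1 h2).resolve_right hbu
  subst ht
  simpa [ha] using h

lemma span_pair_eq_of_finrank_eq_two {C : Submodule L (Fin n → L)} (hdim : finrank L C = 2)
    {a b : Fin n → L} (ha : a ∈ C) (hb : b ∈ C) (hab : LinearIndependent L ![a, b]) :
    Submodule.span L (Set.range ![a, b]) = C := by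
  refine Submodule.eq_of_le_of_finrank_eq (Submodule.span_le.2 ?_) ?_
  · rintro _ ⟨i, rfl⟩
    fin_cases i
    · exact ha
    · exact hb
  · rw [finrank_span_eq_card hab, hdim, Fintype.card_fin]

lemma IsNondegenerateCode.eq_zero {C : Submodule L (Fin n → L)} (hC : IsNondegenerateCode K C)
    (hdim : finrank L C = 2) {a b : Fin n → L} (ha : a ∈ C) (hb : b ∈ C)
    (hab : LinearIndependent L ![a, b]) (u : Fin n → K)
    (hau : Fintype.linearCombination K a u = 0) (hbu : Fintype.linearCombination K b u = 0) :
    u = 0 := by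
  have h := hC 2 (Matrix.of ![a, b]) ⟨hab, span_pair_eq_of_finrank_eq_two hdim ha hb hab⟩
  rw [Fintype.linearIndependent_iff] at h
  refine funext (h u (funext fun i => ?_))
  rw [Finset.sum_apply]
  fin_cases i
  · simpa [Fintype.linearCombination_apply] using hau
  · simpa [Fintype.linearCombination_apply] using hbu

/-- Up to scalars, the codewords of maximum weight are the good `b - y a`, once `a` is not of
maximum weight. -/
lemma numMaxWeight_eq [Finite L] {C : Submodule L (Fin n → L)} (hdim : finrank L C = 2)
    (hn : n ≤ finrank K L) {a b : Fin n → L} (ha : a ∈ C) (hb : b ∈ C)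
    (hab : LinearIndependent L ![a, b])
    (hbad : ¬ Function.Injective (Fintype.linearCombination K a)) :
    numMaxWeight K C = (Nat.card L - 1) * Nat.card {y : L // Function.Injective
      (Fintype.linearCombination K b - y • Fintype.linearCombination K a)} := by
  classical
  have hspan := span_pair_eq_of_finrank_eq_two hdim ha hb hab
  have hinj_smul : ∀ (s : L) (c : Fin n → L), s ≠ 0 →
      (Function.Injective (Fintype.linearCombination K (s • c)) ↔
        Function.Injective (Fintype.linearCombination K c)) := by
    intro s c hs
    rw [linearCombination_smul_left, injective_iff_map_eq_zero, injective_iff_map_eq_zero]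
    simp [hs]
  rw [numMaxWeight, min_eq_right hn]
  have himg : {c : Fin n → L | c ∈ C ∧ rankWeight K c = n} =
      (fun p : Lˣ × {y : L // Function.Injective
        (Fintype.linearCombination K b - y • Fintype.linearCombination K a)} =>
        (p.1 : L) • (b - (p.2 : L) • a)) '' Set.univ := by
    ext c
    rw [Set.image_univ, Set.mem_range, Set.mem_ofPred_eq, rankWeight_eq_iff_injective]
    constructor
    · rintro ⟨hc, hi⟩
      rw [← hspan, Matrix.range_cons, Matrix.range_cons, Matrix.range_empty, Set.union_empty,
        Set.singleton_union, Submodule.mem_span_pair] at hc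
      obtain ⟨s, t, rfl⟩ := hc
      have ht : t ≠ 0 := by
        rintro rfl
        rw [zero_smul, add_zero] at hi
        by_cases hs : s = 0
        · subst hs
          apply hbad
          rw [injective_iff_map_eq_zero] at hi ⊢
          intro u _
          exact hi u (by rw [linearCombination_smul_left, zero_smul, LinearMap.zero_apply])
        · exact hbad ((hinj_smul s a hs).1 hi)
      have heq : s • a + t • b = t • (b - (-(s / t)) • a) := by
        rw [smul_sub, smul_smul]
        have : t * -(s / t) = -s := by field_simp
        rw [this, neg_smul, sub_neg_eq_add, add_comm]
      rw [heq, hinj_smul t _ ht, linearCombination_sub_smul_left] at hi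
      exact ⟨(Units.mk0 t ht, ⟨-(s / t), hi⟩), heq.symm⟩
    · rintro ⟨⟨t, y, hy⟩, rfl⟩
      refine ⟨C.smul_mem _ (C.sub_mem hb (C.smul_mem _ ha)), ?_⟩
      rw [hinj_smul _ _ t.ne_zero, linearCombination_sub_smul_left]
      exact hy
  rw [himg, Set.ncard_image_of_injective, Set.ncard_univ, Nat.card_prod, Nat.card_units]
  rintro ⟨t, y, hy⟩ ⟨t', y', hy'⟩ h
  have h1 : (t' * y' - t * y : L) • a + (t - t' : L) • b = 0 := by
    have h2 : (t : L) • (b - y • a) = (t' : L) • (b - y' • a) := h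
    rw [smul_sub, smul_sub, smul_smul, smul_smul] at h2
    rw [sub_smul, sub_smul, ← sub_eq_zero.2 h2]
    abel
  obtain ⟨h3, h4⟩ := LinearIndependent.pair_iff.1 hab _ _ h1
  have h5 : t = t' := Units.ext (sub_eq_zero.1 h4)
  subst h5
  have h6 : y = y' := by
    rw [← mul_sub] at h3
    exact (sub_eq_zero.1 ((mul_eq_zero.1 h3).resolve_left t.ne_zero)).symm
  subst h6
  rfl

/-- In a two-dimensional code every relation among coordinates is satisfied by a nonzero
codeword. -/
lemma exists_mem_linearCombination_eq_zero {C : Submodule L (Fin n → L)}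
    (hdim : finrank L C = 2) (u : Fin n → K) :
    ∃ a ∈ C, a ≠ 0 ∧ Fintype.linearCombination K a u = 0 := by
  let ev : C →ₗ[L] L :=
    { toFun := fun c => Fintype.linearCombination K (c : Fin n → L) u
      map_add' := fun c d => by
        simp [Fintype.linearCombination_apply, Finset.sum_add_distrib]
      map_smul' := fun s c => by
        rw [Submodule.coe_smul, linearCombination_smul_left]; rfl }
  have hfin : FiniteDimensional L C := FiniteDimensional.of_finrank_pos (by omega)
  have hk : LinearMap.ker ev ≠ ⊥ := LinearMap.ker_ne_bot_of_finrank_lt (by simp [hdim])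
  obtain ⟨a, hak, ha0⟩ := Submodule.exists_mem_ne_zero_of_ne_bot hk
  exact ⟨a, a.2, by simpa using ha0, hak⟩

end Codes

/-! ### Linear systems with diagonal powers of an indeterminate -/

section DegreeArgument

open Polynomial

variable {L ι : Type*} [Field L]

/-- The degree of `γ k` is that of `γ o` minus the sum of `q ^ w v` over the vertices `v` of a
chain `P` from `o` (excluded) to `k` (included), all earlier vertices having larger degree. -/
def IsDegreeChain (q : ℕ) (o : ι) (w : ι → ℕ) (γ : ι → L[X]) (k : ι) (P : Finset ι) : Prop :=
  (k ≠ o → k ∈ P) ∧ (k = o → P = ∅) ∧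
    (∀ v ∈ P, v ≠ k → (γ k).natDegree < (γ v).natDegree) ∧
    (γ k).natDegree + ∑ v ∈ P, q ^ w v = (γ o).natDegree

/-- By uniqueness of base `q` digits the degree determines the chain, and its last vertex is the
one of least degree. -/
lemma IsDegreeChain.eq_of_natDegree_eq {q : ℕ} (hq : 2 ≤ q) {o : ι} {w : ι → ℕ}
    (hw : Function.Injective w) {γ : ι → L[X]} {i j : ι} {P P' : Finset ι}
    (hi : IsDegreeChain q o w γ i P) (hj : IsDegreeChain q o w γ j P')
    (hij : (γ i).natDegree = (γ j).natDegree) : i = j := by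
  classical
  obtain ⟨p1, p2, -, p4⟩ := hi
  obtain ⟨p1', -, p3', p4'⟩ := hj
  have hP : P = P' := by
    apply Finset.image_injective hw
    apply Finset.geomSum_injective hq
    simp only
    rw [Finset.sum_image hw.injOn, Finset.sum_image hw.injOn]
    omega
  subst hP
  by_contra hne
  by_cases hio : i = o
  · have := p1' (fun hjo => hne (hio.trans hjo.symm))
    rw [p2 hio] at this
    simp at this
  · have := p3' i (p1 hio) hne
    omega

variable [Fintype ι]

lemma coeff_sum_ne_zero_of_dominant (g : ι → L) (γ : ι → L[X]) (p : ι) (hp : γ p ≠ 0)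
    (hg : g p ≠ 0)
    (h : ∀ i, i ≠ p → g i ≠ 0 → γ i ≠ 0 → (γ i).natDegree < (γ p).natDegree) :
    (∑ i, C (g i) * γ i).coeff (γ p).natDegree ≠ 0 := by
  rw [finsetSum_coeff, Finset.sum_eq_single p]
  · rw [coeff_C_mul]
    exact mul_ne_zero hg (leadingCoeff_ne_zero.2 hp)
  · intro i _ hi
    rw [coeff_C_mul]
    by_cases h1 : g i = 0
    · rw [h1, zero_mul]
    by_cases h2 : γ i = 0
    · rw [h2, coeff_zero, mul_zero]
    rw [coeff_eq_zero_of_natDegree_lt (h i hi h1 h2), mul_zero]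
  · intro hh
    exact absurd (Finset.mem_univ p) hh

/-- A solution of a linear system with diagonal `Y ^ (q ^ w k)` and constant coefficients `g`: every
nonzero entry has a degree chain, obtained by prolonging that of a predecessor `p` whose coefficient
`g p k` is nonzero. The terms `g i k * γ i` of degree above `γ k` have distinct degrees, so the
largest one determines the degree of their sum. -/
lemma exists_chain_of_linear_system {q : ℕ} (hq : 2 ≤ q) (o : ι) (w : ι → ℕ)
    (hw : Function.Injective w) (γ : ι → L[X]) (g : ι → ι → L)
    (h : ∀ k, k ≠ o → γ k * X ^ q ^ w k = ∑ i, C (g i k) * γ i) (k : ι) (hk : γ k ≠ 0) :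
    (∃ P, IsDegreeChain q o w γ k P) ∧
    (k ≠ o → ∃ p, γ p ≠ 0 ∧ g p k ≠ 0 ∧ (γ k).natDegree < (γ p).natDegree) := by
  classical
  obtain ⟨B, hB⟩ : ∃ B, ∀ i, (γ i).natDegree ≤ B :=
    ⟨Finset.univ.sup fun i => (γ i).natDegree, fun i =>
      Finset.le_sup (f := fun i => (γ i).natDegree) (Finset.mem_univ i)⟩
  induction hd : B - (γ k).natDegree using Nat.strong_induction_on generalizing k with
  | _ d ih =>
  by_cases hko : k = o
  · subst hko
    exact ⟨⟨∅, by simp [IsDegreeChain]⟩, fun hh => absurd rfl hh⟩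
  have ih' : ∀ i, γ i ≠ 0 → (γ k).natDegree < (γ i).natDegree →
      ∃ P, IsDegreeChain q o w γ i P := by
    intro i hi hlt
    have := hB i
    exact (ih (B - (γ i).natDegree) (by omega) i hi rfl).1
  have hdist : ∀ i j, γ i ≠ 0 → γ j ≠ 0 → (γ k).natDegree < (γ i).natDegree →
      (γ i).natDegree = (γ j).natDegree → i = j := by
    intro i j hi hj hlt hij
    obtain ⟨P, hP⟩ := ih' i hi hlt
    obtain ⟨P', hP'⟩ := ih' j hj (hij ▸ hlt)
    exact hP.eq_of_natDegree_eq hq hw hP' hij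
  have hdegk : (γ k * X ^ q ^ w k).natDegree = (γ k).natDegree + q ^ w k := by
    rw [natDegree_mul hk (pow_ne_zero _ X_ne_zero), natDegree_X_pow]
  have hqpos : 0 < q ^ w k := by positivity
  -- The predecessor is the term of largest degree.
  let S : Finset ι := Finset.univ.filter fun i =>
    γ i ≠ 0 ∧ g i k ≠ 0 ∧ (γ k).natDegree < (γ i).natDegree
  obtain ⟨i₀, hi₀, hi₀d⟩ : ∃ i ∈ S, (γ k).natDegree + q ^ w k ≤ (γ i).natDegree := by
    have hc : (∑ i, C (g i k) * γ i).coeff ((γ k).natDegree + q ^ w k) ≠ 0 := by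
      rw [← h k hko, ← hdegk, coeff_natDegree, leadingCoeff_ne_zero]
      exact mul_ne_zero hk (pow_ne_zero _ X_ne_zero)
    rw [finsetSum_coeff] at hc
    obtain ⟨i, -, hi⟩ := Finset.exists_ne_zero_of_sum_ne_zero hc
    rw [coeff_C_mul] at hi
    have h1 := le_natDegree_of_ne_zero (right_ne_zero_of_mul hi)
    refine ⟨i, ?_, h1⟩
    simp only [S, Finset.mem_filter, Finset.mem_univ, true_and]
    refine ⟨fun h0 => hi (by rw [h0, coeff_zero, mul_zero]), left_ne_zero_of_mul hi, by omega⟩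
  obtain ⟨p, hpS, hpmax⟩ := Finset.exists_max_image S (fun i => (γ i).natDegree) ⟨i₀, hi₀⟩
  obtain ⟨hp0, hgp, hplt⟩ : γ p ≠ 0 ∧ g p k ≠ 0 ∧ (γ k).natDegree < (γ p).natDegree := by
    simpa [S] using hpS
  have hpd : (γ p).natDegree = (γ k).natDegree + q ^ w k := by
    refine le_antisymm ?_ (hi₀d.trans (hpmax i₀ hi₀))
    rw [← hdegk, h k hko]
    refine le_natDegree_of_ne_zero (coeff_sum_ne_zero_of_dominant _ γ p hp0 hgp ?_)
    intro i hip hgi hγi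
    by_cases hlt : (γ k).natDegree < (γ i).natDegree
    · have hle := hpmax i (by simp [S, hγi, hgi, hlt])
      exact lt_of_le_of_ne hle fun heq => hip (hdist i p hγi hp0 hlt heq)
    · omega
  refine ⟨?_, fun _ => ⟨p, hp0, hgp, hplt⟩⟩
  obtain ⟨P, -, -, p3, p4⟩ := ih' p hp0 hplt
  have hPk : ∀ v ∈ P, (γ k).natDegree < (γ v).natDegree := by
    intro v hv
    by_cases hvp : v = p
    · rw [hvp]; exact hplt
    · exact hplt.trans (p3 v hv hvp)
  have hkP : k ∉ P := fun hh => lt_irrefl _ (hPk k hh)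
  refine ⟨insert k P, fun _ => Finset.mem_insert_self _ _, fun hh => absurd hh hko,
    fun v hv hvk => hPk v (Finset.mem_of_mem_insert_of_ne hv hvk), ?_⟩
  rw [Finset.sum_insert hkP]
  omega

/-- The nonzero entries of such a solution have distinct degrees, so no cancellation can occur and
the support is closed under following nonzero coefficients. -/
lemma ne_zero_of_linear_system {q : ℕ} (hq : 2 ≤ q) (o : ι) (w : ι → ℕ)
    (hw : Function.Injective w) (γ : ι → L[X]) (g : ι → ι → L)
    (h : ∀ k, k ≠ o → γ k * X ^ q ^ w k = ∑ i, C (g i k) * γ i) {i k : ι} (hi : γ i ≠ 0)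
    (hik : g i k ≠ 0) (hk : k ≠ o) : γ k ≠ 0 := by
  classical
  intro hk0
  have hdist : ∀ i j, γ i ≠ 0 → γ j ≠ 0 → (γ i).natDegree = (γ j).natDegree → i = j := by
    intro i j hi hj hij
    obtain ⟨P, hP⟩ := (exists_chain_of_linear_system hq o w hw γ g h i hi).1
    obtain ⟨P', hP'⟩ := (exists_chain_of_linear_system hq o w hw γ g h j hj).1
    exact hP.eq_of_natDegree_eq hq hw hP' hij
  let S : Finset ι := Finset.univ.filter fun j => γ j ≠ 0 ∧ g j k ≠ 0
  obtain ⟨p, hpS, hpmax⟩ := Finset.exists_max_image S (fun j => (γ j).natDegree)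
    ⟨i, by simp [S, hi, hik]⟩
  obtain ⟨hp0, hgp⟩ : γ p ≠ 0 ∧ g p k ≠ 0 := by simpa [S] using hpS
  refine coeff_sum_ne_zero_of_dominant (fun j => g j k) γ p hp0 hgp ?_ ?_
  · intro j hjp hgj hγj
    exact lt_of_le_of_ne (hpmax j (by simp [S, hγj, hgj])) fun heq => hjp (hdist j p hγj hp0 heq)
  · rw [← h k hk, hk0, zero_mul, coeff_zero]

end DegreeArgument

section Cyclic

open Polynomial

variable {L : Type*} [Field L]

/-- For a circulant system indexed by `ZMod m` the support of the solution is a submonoid. -/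
lemma add_ne_zero_of_circulant_system {q m : ℕ} [NeZero m] (hq : 2 ≤ q) (γ : ZMod m → L[X])
    (g : ZMod m → ZMod m → L) (f : ZMod m → L) (hg : ∀ i k, g i k ≠ 0 ↔ f (k - i) ≠ 0)
    (h : ∀ k, k ≠ 0 → γ k * X ^ q ^ k.val = ∑ i, C (g i k) * γ i) (h0 : γ 0 ≠ 0)
    (k l : ZMod m) (hk : γ k ≠ 0) (hl : γ l ≠ 0) : γ (k + l) ≠ 0 := by
  obtain ⟨B, hB⟩ : ∃ B, ∀ i, (γ i).natDegree ≤ B :=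
    ⟨Finset.univ.sup fun i => (γ i).natDegree, fun i =>
      Finset.le_sup (f := fun i => (γ i).natDegree) (Finset.mem_univ i)⟩
  induction hd : B - (γ l).natDegree using Nat.strong_induction_on generalizing l with
  | _ d ih =>
  by_cases hl0 : l = 0
  · rwa [hl0, add_zero]
  obtain ⟨p, hp, hgp, hlt⟩ := (exists_chain_of_linear_system hq 0 ZMod.val
    (ZMod.val_injective m) γ g h l hl).2 hl0
  have hkp := ih (B - (γ p).natDegree) (by have := hB p; omega) p hp rfl
  by_cases hkl : k + l = 0
  · rwa [hkl]
  refine ne_zero_of_linear_system hq 0 ZMod.val (ZMod.val_injective m) γ g h hkp ?_ hkl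
  rw [hg] at hgp ⊢
  rwa [add_sub_add_left_eq_sub]

end Cyclic

/-! ### Linearized polynomials -/

section Linearized

open Polynomial

variable (K : Type*) [Field K] [Fintype K]

lemma exists_algHom_pow_card_pow (R : Type*) [CommRing R] [Algebra K R] (i : ℕ) :
    ∃ φ : R →ₐ[K] R, ∀ x, φ x = x ^ Fintype.card K ^ i := by
  induction i with
  | zero => exact ⟨AlgHom.id K R, fun x => by simp⟩
  | succ i ih =>
    obtain ⟨φ, hφ⟩ := ih
    refine ⟨(FiniteField.frobeniusAlgHom K R).comp φ, fun x => ?_⟩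
    rw [AlgHom.comp_apply, hφ, FiniteField.frobeniusAlgHom_apply, ← pow_mul, pow_succ]

lemma FiniteField.prod_X_sub_C : ∏ r : K, (X - C r : K[X]) = X ^ Fintype.card K - X := by
  have hq : 1 < Fintype.card K := Fintype.one_lt_card
  have h1 : (∏ r : K, (X - C r : K[X])).Monic := monic_prod_of_monic _ _ fun _ _ => monic_X_sub_C _
  have h2 : (X ^ Fintype.card K - X : K[X]).Monic :=
    monic_X_pow_sub (by rw [degree_X]; exact_mod_cast hq)
  have h3 : ∏ r : K, (X - C r : K[X]) ∣ X ^ Fintype.card K - X :=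
    prod_X_sub_C_dvd_of_injOn Finset.univ (fun r : K => r) (Set.injOn_id _)
      fun r _ => by rw [eval_sub, eval_pow, eval_X, FiniteField.pow_card, sub_self]
  have h4 : (∏ r : K, (X - C r : K[X])).natDegree = Fintype.card K := by
    rw [natDegree_prod_of_monic _ _ fun _ _ => monic_X_sub_C _]
    simp only [natDegree_X_sub_C, Finset.sum_const, Finset.card_univ, smul_eq_mul, mul_one]
  exact (eq_of_monic_of_dvd_of_natDegree_le h1 h2 h3
    (by rw [h4, FiniteField.X_pow_card_sub_X_natDegree_eq _ hq])).symm

lemma FiniteField.prod_sub_algebraMap_mul {F : Type*} [Field F] [Algebra K F] (z w : F) :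
    ∏ r : K, (z - algebraMap K F r * w) = z ^ Fintype.card K - w ^ (Fintype.card K - 1) * z := by
  have hq : 1 < Fintype.card K := Fintype.one_lt_card
  by_cases hw : w = 0
  · simp [hw, show Fintype.card K - 1 ≠ 0 by omega]
  have h1 := congrArg (aeval (z / w)) (FiniteField.prod_X_sub_C K)
  simp only [map_prod, map_sub, map_pow, aeval_X, aeval_C] at h1
  have h2 : ∏ r : K, (z - algebraMap K F r * w)
      = w ^ Fintype.card K * ∏ r : K, (z / w - algebraMap K F r) := by
    rw [← Finset.card_univ, ← Finset.prod_const, ← Finset.prod_mul_distrib]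
    refine Finset.prod_congr rfl fun r _ => ?_
    field_simp
  have h3 : w ^ Fintype.card K = w ^ (Fintype.card K - 1) * w := by
    rw [← pow_succ, Nat.sub_add_cancel hq.le]
  rw [h2, h1, mul_sub, ← mul_pow, mul_div_cancel₀ _ hw, h3, mul_assoc, mul_div_cancel₀ _ hw]

lemma FiniteField.prod_sub_smul {B : Type*} [CommRing B] [IsDomain B] [Algebra K B] (z w : B) :
    ∏ r : K, (z - r • w) = z ^ Fintype.card K - w ^ (Fintype.card K - 1) * z := by
  apply IsFractionRing.injective B (FractionRing B)
  have h := FiniteField.prod_sub_algebraMap_mul K (algebraMap B (FractionRing B) z)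
    (algebraMap B (FractionRing B) w)
  rw [map_sub, map_mul, map_pow, map_pow, ← h, map_prod]
  refine Finset.prod_congr rfl fun r _ => ?_
  rw [map_sub, Algebra.smul_def, map_mul, ← IsScalarTower.algebraMap_apply]

variable {A : Type*} [CommRing A]

/-- The `A`-module of linearized polynomials `∑ cᵢ X ^ (q ^ i)`, where `q = |K|`. -/
noncomputable def linearizedPolynomials (A : Type*) [CommRing A] : Submodule A A[X] :=
  Submodule.span A (Set.range fun i : ℕ => (X : A[X]) ^ Fintype.card K ^ i)

variable {K}

lemma comp_X_sub_C_of_mem_linearized [Algebra K A] {P : A[X]}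
    (hP : P ∈ linearizedPolynomials K A) (r : K) (w : A) :
    P.comp (X - C (r • w)) = P - r • C (P.eval w) := by
  induction hP using Submodule.span_induction with
  | mem P h =>
    obtain ⟨i, rfl⟩ := h
    obtain ⟨φ, hφ⟩ := exists_algHom_pow_card_pow K A[X] i
    simp only [X_pow_comp, eval_pow, eval_X]
    rw [← hφ, map_sub, ← smul_C, map_smul, hφ, hφ, C_pow]
  | zero => simp
  | add P Q _ _ hP hQ =>
    rw [add_comp, hP, hQ, eval_add, C_add, smul_add]
    abel
  | smul a P _ hP =>
    rw [smul_comp, hP, eval_smul, smul_sub, smul_eq_mul, C_mul, ← smul_eq_C_mul,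
      smul_comm r a]

lemma pow_card_mem_linearized [Algebra K A] {P : A[X]} (hP : P ∈ linearizedPolynomials K A) :
    P ^ Fintype.card K ∈ linearizedPolynomials K A := by
  obtain ⟨φ, hφ⟩ := exists_algHom_pow_card_pow K A[X] 1
  simp only [pow_one] at hφ
  induction hP using Submodule.span_induction with
  | mem P h =>
    obtain ⟨i, rfl⟩ := h
    exact Submodule.subset_span ⟨i + 1, by simp only [← pow_mul, pow_succ]⟩
  | zero => rw [zero_pow Fintype.card_ne_zero]; exact Submodule.zero_mem _
  | add P Q _ _ hP hQ =>
    rw [← hφ, map_add, hφ, hφ]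
    exact Submodule.add_mem _ hP hQ
  | smul a P _ hP =>
    rw [_root_.smul_pow]
    exact Submodule.smul_mem _ _ hP

/-- The polynomial whose roots are the values of a `K`-linear map is linearized. -/
lemma prod_X_sub_C_mem_linearized [IsDomain A] [Algebra K A] (n : ℕ)
    (ψ : (Fin n → K) →ₗ[K] A) :
    ∏ u, (X - C (ψ u)) ∈ linearizedPolynomials K A := by
  induction n with
  | zero =>
    rw [Fintype.prod_unique]
    have : ψ default = 0 := by rw [Subsingleton.elim default (0 : Fin 0 → K), map_zero]
    rw [this, C_0, sub_zero]
    exact Submodule.subset_span ⟨0, by simp⟩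
  | succ n ih =>
    let e := Fin.consLinearEquiv K (fun _ : Fin (n + 1) => K)
    let ψ' : (Fin n → K) →ₗ[K] A := (ψ.comp e.toLinearMap).comp (LinearMap.inr K K (Fin n → K))
    let w : A := ψ (e (1, 0))
    set P := ∏ v, (X - C (ψ' v)) with hPdef
    have hP := ih ψ'
    have h1 : ∏ u, (X - C (ψ u)) = ∏ r : K, P.comp (X - C (r • w)) := by
      rw [← e.toEquiv.prod_comp, Fintype.prod_prod_type]
      refine Finset.prod_congr rfl fun r _ => ?_
      rw [hPdef, prod_comp]
      refine Finset.prod_congr rfl fun v _ => ?_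
      have h2 : ψ (e.toEquiv (r, v)) = r • w + ψ' v := by
        have : (r, v) = r • ((1 : K), (0 : Fin n → K)) + (0, v) := by simp
        change ψ (e (r, v)) = _
        rw [this, map_add, map_add, map_smul, map_smul]
        rfl
      rw [h2, sub_comp, X_comp, C_comp, C_add, sub_sub]
    have h3 : ∏ r : K, P.comp (X - C (r • w)) = P ^ Fintype.card K
        - (P.eval w) ^ (Fintype.card K - 1) • P := by
      rw [Finset.prod_congr rfl fun r _ => comp_X_sub_C_of_mem_linearized hP r w,
        FiniteField.prod_sub_smul, smul_eq_C_mul, C_pow]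
    rw [h1, h3]
    exact Submodule.sub_mem _ (pow_card_mem_linearized hP) (Submodule.smul_mem _ _ hP)

lemma eval_eq_sum_of_mem_linearized {P : A[X]} (hP : P ∈ linearizedPolynomials K A) {m : ℕ}
    (hm : P.natDegree ≤ Fintype.card K ^ m) (x : A) :
    P.eval x = ∑ i ∈ Finset.range (m + 1),
      P.coeff (Fintype.card K ^ i) * x ^ Fintype.card K ^ i := by
  have hq : 1 < Fintype.card K := Fintype.one_lt_card
  have hinj : Function.Injective fun i : ℕ => Fintype.card K ^ i := Nat.pow_right_injective hq
  have hcoeff : ∀ j, (∀ i, j ≠ Fintype.card K ^ i) → P.coeff j = 0 := by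
    intro j hj
    clear hm
    induction hP using Submodule.span_induction with
    | mem P h =>
      obtain ⟨i, rfl⟩ := h
      simp only
      rw [coeff_X_pow, if_neg (hj i)]
    | zero => simp
    | add P Q _ _ hP hQ => rw [coeff_add, hP, hQ, add_zero]
    | smul a P _ hP => rw [coeff_smul, hP, smul_zero]
  rw [eval_eq_sum_range' (Nat.lt_succ_of_le hm),
    ← Finset.sum_image (f := fun j => P.coeff j * x ^ j) (s := Finset.range (m + 1))
      (g := fun i => Fintype.card K ^ i) hinj.injOn]
  refine (Finset.sum_subset ?_ ?_).symm
  · intro j hj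
    obtain ⟨i, hi, rfl⟩ := Finset.mem_image.1 hj
    rw [Finset.mem_range] at hi ⊢
    exact Nat.lt_succ_of_le (Nat.pow_le_pow_right hq.le (by omega))
  · intro j hj hj'
    rw [hcoeff j, zero_mul]
    rintro i rfl
    refine hj' (Finset.mem_image.2 ⟨i, ?_, rfl⟩)
    rw [Finset.mem_range] at hj ⊢
    have := (Nat.pow_le_pow_iff_right hq).1 (Nat.le_of_lt_succ hj)
    omega

end Linearized

/-! ### Linear endomorphisms of a finite field as linearized polynomials -/

section Frobenius

variable {K L : Type*} [Field K] [Fintype K] [Field L] [Fintype L] [Algebra K L]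

open Polynomial Module

lemma pow_card_pow_mod {m : ℕ} (hm : finrank K L = m) (x : L) (i : ℕ) :
    x ^ Fintype.card K ^ (i % m) = x ^ Fintype.card K ^ i := by
  have hQ : Fintype.card L = Fintype.card K ^ m := by rw [card_eq_pow_finrank (K := K), hm]
  conv_rhs => rw [← Nat.mod_add_div i m, pow_add, pow_mul, pow_mul (Fintype.card K) m, ← hQ,
    FiniteField.pow_card_pow]

/-- The powers `1, τ, …, τ ^ (m - 1)` of the Frobenius map are independent over `L`. -/
lemma eq_zero_of_sum_mul_pow_eq_zero {m : ℕ} [NeZero m] (hm : finrank K L = m) (E : ZMod m → L)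
    (h : ∀ x : L, ∑ k, E k * x ^ Fintype.card K ^ k.val = 0) : E = 0 := by
  have hq : 1 < Fintype.card K := Fintype.one_lt_card
  have hQ : Fintype.card L = Fintype.card K ^ m := by rw [card_eq_pow_finrank (K := K), hm]
  have hP : (∑ k, C (E k) * X ^ Fintype.card K ^ k.val : L[X]) = 0 := by
    refine eq_zero_of_natDegree_lt_card_of_eval_eq_zero' _ Finset.univ
      (fun x _ => by simpa [eval_finsetSum] using h x) ?_
    rw [Finset.card_univ, hQ]
    refine (natDegree_sum_le_of_forall_le (n := Fintype.card K ^ (m - 1)) _ _ ?_).trans_lt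
      (Nat.pow_lt_pow_right hq (Nat.sub_lt (NeZero.pos m) one_pos))
    intro k _
    refine (natDegree_C_mul_X_pow_le _ _).trans (Nat.pow_le_pow_right hq.le ?_)
    have := ZMod.val_lt k
    omega
  funext k
  have h1 := congrArg (fun P => P.coeff (Fintype.card K ^ k.val)) hP
  simp only [finsetSum_coeff, coeff_C_mul, coeff_X_pow, coeff_zero] at h1
  rw [Finset.sum_eq_single k] at h1
  · simpa using h1
  · intro j _ hj
    rw [if_neg, mul_zero]
    exact fun hh => hj (ZMod.val_injective m (Nat.pow_right_injective hq hh)).symm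
  · intro hh
    exact absurd (Finset.mem_univ k) hh

lemma eq_zero_of_sum_mul_C_pow_eq_zero {m : ℕ} [NeZero m] (hm : finrank K L = m)
    (E : ZMod m → L[X]) (h : ∀ x : L, ∑ k, E k * C (x ^ Fintype.card K ^ k.val) = 0) :
    E = 0 := by
  funext k
  ext j
  have := eq_zero_of_sum_mul_pow_eq_zero hm (fun k => (E k).coeff j) fun x => by
    have h1 := congrArg (fun P => P.coeff j) (h x)
    simpa only [finsetSum_coeff, coeff_mul_C, coeff_zero] using h1
  exact congrFun this k

/-- Every `K`-linear endomorphism of `L` is a linearized polynomial. -/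
lemma exists_linearized_repr {m : ℕ} [NeZero m] (hm : finrank K L = m) (f : L →ₗ[K] L) :
    ∃ c : ZMod m → L, ∀ x, f x = ∑ k, c k * x ^ Fintype.card K ^ k.val := by
  choose φ hφ using exists_algHom_pow_card_pow K L
  let T : (ZMod m → L) →ₗ[L] (L →ₗ[K] L) :=
    Fintype.linearCombination L fun k : ZMod m => (φ k.val).toLinearMap
  have hT : ∀ c x, T c x = ∑ k, c k * x ^ Fintype.card K ^ k.val := by
    intro c x
    simp [T, Fintype.linearCombination_apply, hφ]
  have hinj : Function.Injective T := by
    rw [injective_iff_map_eq_zero]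
    intro c hc
    exact eq_zero_of_sum_mul_pow_eq_zero hm c fun x => by rw [← hT, hc, LinearMap.zero_apply]
  have hsurj : Function.Surjective T := by
    refine (LinearMap.injective_iff_surjective_of_finrank_eq_finrank ?_).1 hinj
    rw [finrank_linearMap_self, finrank_fintype_fun_eq_card, ZMod.card, hm]
  obtain ⟨c, hc⟩ := hsurj f
  exact ⟨c, fun x => by rw [← hT, hc]⟩

end Frobenius

/-! ### Linear sets of maximum rank -/

section MaximumRank

variable {K L : Type*} [Field K] [Field L] [Algebra K L]

open Polynomial Module

/-- The order of vanishing at `0` is the size of the kernel. -/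
lemma exists_prod_X_sub_C_eq_X_pow_mul {V : Type*} [AddCommGroup V] [Module K V] [Fintype V]
    (φ : V →ₗ[K] L) :
    ∃ G : L[X], ∏ u, (X - C (φ u)) = G * X ^ Nat.card (LinearMap.ker φ) ∧ G.coeff 0 ≠ 0 := by
  classical
  refine ⟨∏ u with φ u ≠ 0, (X - C (φ u)), ?_, ?_⟩
  · rw [← Finset.prod_filter_not_mul_prod_filter Finset.univ fun u => φ u = 0]
    congr 1
    have hcard : Nat.card (LinearMap.ker φ) = (Finset.univ.filter fun u => φ u = 0).card := by
      rw [← Set.ncard_coe_finset]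
      change Set.ncard (LinearMap.ker φ : Set V) = _
      congr 1
      ext u
      simp
    rw [hcard, ← Finset.prod_const]
    refine Finset.prod_congr rfl fun u hu => ?_
    rw [(Finset.mem_filter.1 hu).2, C_0, sub_zero]
  · rw [coeff_zero_prod, Finset.prod_ne_zero_iff]
    intro u hu
    simpa using (Finset.mem_filter.1 hu).2

variable {V : Type*} [AddCommGroup V] [Module K V] [Fintype V]

lemma eval_coeff_redei (α β : V →ₗ[K] L) (y : L) (j : ℕ) :
    ((redei α β).coeff j).eval y = (∏ u, (X - C ((β - y • α) u)) : L[X]).coeff j := by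
  rw [← map_redei, coeff_map, coe_evalRingHom]

/-- In maximum rank, a direction of weight zero makes the Rédei polynomial `X ^ |L| - X`. -/
lemma eval_coeff_redei_of_injective [Fintype L] (hV : Fintype.card V = Fintype.card L)
    (α β : V →ₗ[K] L) (y : L) (hy : Function.Injective (β - y • α)) {j : ℕ} (hj : 1 < j)
    (hjL : j < Fintype.card L) : ((redei α β).coeff j).eval y = 0 := by
  have hL := Fintype.one_lt_card (α := L)
  have hprod : (∏ u, (X - C ((β - y • α) u)) : L[X]) = X ^ Fintype.card L - X := by
    have h1 : (∏ u, (X - C ((β - y • α) u)) : L[X]).natDegree = Fintype.card L := by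
      rw [natDegree_prod_of_monic _ _ fun _ _ => monic_X_sub_C _]
      simp only [natDegree_X_sub_C, Finset.sum_const, Finset.card_univ, smul_eq_mul, mul_one]
      exact hV
    have h2 : (X ^ Fintype.card L - X : L[X]).Monic :=
      monic_X_pow_sub (by rw [degree_X]; exact_mod_cast hL)
    refine (eq_of_monic_of_dvd_of_natDegree_le
      (monic_prod_of_monic _ _ fun _ _ => monic_X_sub_C _) h2
      (prod_X_sub_C_dvd_of_injOn _ _ hy.injOn fun u _ => ?_) ?_).symm
    · rw [eval_sub, eval_pow, eval_X, FiniteField.pow_card, sub_self]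
    · rw [h1, FiniteField.X_pow_card_sub_X_natDegree_eq _ hL]
  rw [eval_coeff_redei, hprod, coeff_sub, coeff_X_pow, coeff_X, if_neg (by omega),
    if_neg (by omega), sub_zero]

lemma eval_coeff_redei_of_lt_card_ker (α β : V →ₗ[K] L) (y : L) {j : ℕ}
    (hj : j < Nat.card (LinearMap.ker (β - y • α))) : ((redei α β).coeff j).eval y = 0 := by
  obtain ⟨G, hG, -⟩ := exists_prod_X_sub_C_eq_X_pow_mul (β - y • α)
  rw [eval_coeff_redei, hG, coeff_mul_X_pow', if_neg (not_le.2 hj)]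

lemma coeff_redei_card_ker_ne_zero (α β : V →ₗ[K] L) :
    (redei α β).coeff (Nat.card (LinearMap.ker β)) ≠ 0 := by
  intro h0
  have h1 := eval_coeff_redei α β 0 (Nat.card (LinearMap.ker β))
  obtain ⟨G, hG, hG0⟩ := exists_prod_X_sub_C_eq_X_pow_mul β
  rw [h0, eval_zero, zero_smul, sub_zero, hG, coeff_mul_X_pow', if_pos le_rfl, Nat.sub_self] at h1
  exact hG0 h1.symm

/-- If every direction has weight zero or at least `e`, the coefficients of `X ^ j` for
`1 < j < |K| ^ e` vanish on all of `L`, and their degree is too small for that. -/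
lemma coeff_redei_eq_zero [Fintype L] (hV : Fintype.card V = Fintype.card L)
    (α β : V →ₗ[K] L) {j : ℕ} (hj : 1 < j) (hjL : j < Fintype.card L)
    (h : ∀ y : L, ¬ Function.Injective (β - y • α) →
      j < Nat.card (LinearMap.ker (β - y • α))) :
    (redei α β).coeff j = 0 := by
  refine eq_zero_of_natDegree_lt_card_of_eval_eq_zero' _ Finset.univ (fun y _ => ?_) ?_
  · by_cases hy : Function.Injective (β - y • α)
    · exact eval_coeff_redei_of_injective hV α β y hy hj hjL
    · exact eval_coeff_redei_of_lt_card_ker α β y (h y hy)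
  · rw [Finset.card_univ]
    by_cases hne : (redei α β).coeff j = 0
    · rw [hne, natDegree_zero]
      omega
    · have h1 := totalDegreeLE_redei α β j
      rw [degree_eq_natDegree hne, hV] at h1
      have h2 : ((redei α β).coeff j).natDegree + j ≤ Fintype.card L := by exact_mod_cast h1
      omega

/-- The `K`-linear map whose values are the roots of the Rédei polynomial. -/
noncomputable def redeiRoot (α β : V →ₗ[K] L) : V →ₗ[K] L[X] where
  toFun u := C (β u) - X * C (α u)
  map_add' u v := by
    simp only [map_add]
    ring
  map_smul' r u := by
    simp only [map_smul, RingHom.id_apply, smul_sub, ← smul_C, mul_smul_comm]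

/-- The Rédei polynomial is linearized, and vanishes at `β u - Y α u`. -/
lemma sum_coeff_redei_mul_eq_zero [Fintype K] {m : ℕ} (α β : (Fin m → K) →ₗ[K] L)
    (u : Fin m → K) :
    ∑ i ∈ Finset.range (m + 1), (redei α β).coeff (Fintype.card K ^ i) *
      (C (β u ^ Fintype.card K ^ i) - X ^ Fintype.card K ^ i * C (α u ^ Fintype.card K ^ i))
      = 0 := by
  classical
  have hmem : redei α β ∈ linearizedPolynomials K L[X] :=
    prod_X_sub_C_mem_linearized m (redeiRoot α β)
  have h0 : (redei α β).eval (redeiRoot α β u) = 0 := by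
    rw [redei, eval_prod]
    refine Finset.prod_eq_zero (Finset.mem_univ u) ?_
    rw [eval_sub, eval_X, eval_C]
    exact sub_self _
  have hdeg : (redei α β).natDegree ≤ Fintype.card K ^ m := by
    rw [natDegree_redei]
    simp
  rw [eval_eq_sum_of_mem_linearized hmem hdeg] at h0
  rw [← h0]
  refine Finset.sum_congr rfl fun i _ => ?_
  obtain ⟨φ, hφ⟩ := exists_algHom_pow_card_pow K L[X] i
  have h1 : redeiRoot α β u = C (β u) - X * C (α u) := rfl
  rw [h1, ← hφ (C (β u) - X * C (α u)), map_sub, map_mul, hφ, hφ, hφ, C_pow, C_pow]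

/-- Comparing coefficients of `x ^ (q ^ k)` in a linearized relation satisfied by `f x - Y x`
for all `x` gives a circulant linear system for the coefficients of the relation. -/
lemma circulant_system_of_linearized_relation [Fintype K] [Fintype L] {m : ℕ} [NeZero m]
    (hm : finrank K L = m) (F : ZMod m → L) (f : L → L)
    (hf : ∀ x, f x = ∑ k, F k * x ^ Fintype.card K ^ k.val) (c : ℕ → L[X]) (hcm : c m = 1)
    (hroot : ∀ x : L, ∑ i ∈ Finset.range (m + 1), c i *
      (C (f x ^ Fintype.card K ^ i) - X ^ Fintype.card K ^ i * C (x ^ Fintype.card K ^ i)) = 0)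
    (k : ZMod m) (hk : k ≠ 0) :
    c k.val * X ^ Fintype.card K ^ k.val = ∑ i : ZMod m,
      C (F (k - i) ^ Fintype.card K ^ i.val) * (c i.val + if i = 0 then 1 else 0) := by
  set q := Fintype.card K with hqdef
  have hQ : Fintype.card L = q ^ m := by rw [card_eq_pow_finrank (K := K), hm]
  set γ : ZMod m → L[X] := fun k => c k.val + if k = 0 then 1 else 0 with hγ
  set g : ZMod m → ZMod m → L := fun i k => F (k - i) ^ q ^ i.val with hg
  have hfpow : ∀ (x : L) (i : ZMod m),
      f x ^ q ^ i.val = ∑ k, g i k * x ^ q ^ k.val := by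
    intro x i
    obtain ⟨φ, hφ⟩ := exists_algHom_pow_card_pow K L i.val
    rw [← hqdef] at hφ
    rw [← hφ, hf, map_sum, ← (Equiv.subRight i).sum_comp]
    refine Finset.sum_congr rfl fun k _ => ?_
    rw [map_mul, hφ, hφ, Equiv.subRight_apply, ← pow_mul, ← pow_add,
      ← pow_card_pow_mod hm x ((k - i).val + i.val), ← ZMod.val_add, sub_add_cancel]
  have hsumZ : ∀ G : ℕ → L[X], ∑ i ∈ Finset.range m, G i = ∑ k : ZMod m, G k.val := by
    intro G
    obtain ⟨t, rfl⟩ : ∃ t, m = t + 1 := ⟨m - 1, by have := NeZero.pos m; omega⟩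
    exact Finset.sum_range G
  -- Comparing coefficients of `x ^ (q ^ k)`.
  set E : ZMod m → L[X] := fun k => ∑ i, C (g i k) * γ i -
    (c k.val * X ^ q ^ k.val + if k = 0 then X ^ q ^ m else 0) with hE
  have hE0 : E = 0 := by
    refine eq_zero_of_sum_mul_C_pow_eq_zero hm E fun x => ?_
    have h1 := hroot x
    have hxm : ∀ z : L, z ^ q ^ m = z := fun z => by rw [← hQ, FiniteField.pow_card]
    rw [Finset.sum_range_succ, hcm, one_mul, hxm, hxm, hsumZ] at h1
    have h2 : C (f x) = ∑ i : ZMod m, (if i = 0 then 1 else 0) * C (f x ^ q ^ i.val) := by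
      simp
    have h3 : ∑ i, γ i * C (f x ^ q ^ i.val) = ∑ k, (∑ i, C (g i k) * γ i) * C (x ^ q ^ k.val) := by
      simp only [hfpow, map_sum, Finset.mul_sum, Finset.sum_mul]
      rw [Finset.sum_comm]
      refine Finset.sum_congr rfl fun k _ => Finset.sum_congr rfl fun i _ => ?_
      rw [C_mul]
      ring
    have h4 : X ^ q ^ m * C x
        = ∑ k : ZMod m, (if k = 0 then X ^ q ^ m else 0) * C (x ^ q ^ k.val) := by
      simp
    calc ∑ k, E k * C (x ^ q ^ k.val)
        = ∑ k, (∑ i, C (g i k) * γ i) * C (x ^ q ^ k.val)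
          - ∑ k : ZMod m, c k.val * X ^ q ^ k.val * C (x ^ q ^ k.val)
          - ∑ k : ZMod m, (if k = 0 then X ^ q ^ m else 0) * C (x ^ q ^ k.val) := by
          rw [← Finset.sum_sub_distrib, ← Finset.sum_sub_distrib]
          refine Finset.sum_congr rfl fun k _ => ?_
          simp only [hE]
          ring
      _ = ∑ i : ZMod m, c i.val * (C (f x ^ q ^ i.val) - X ^ q ^ i.val * C (x ^ q ^ i.val))
          + (C (f x) - X ^ q ^ m * C x) := by
          rw [← h3, ← h4, h2, ← add_sub_assoc, ← Finset.sum_add_distrib, ← Finset.sum_sub_distrib]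
          congr 1
          refine Finset.sum_congr rfl fun k _ => ?_
          simp only [hγ]
          ring
      _ = 0 := h1
  have h1 := congrFun hE0 k
  simp only [hE, if_neg hk, add_zero, Pi.zero_apply] at h1
  exact (sub_eq_zero.1 h1).symm

/-- For a linear set of maximum rank `m` the minimum weight `e` divides `m`: the support of the
Rédei coefficients `c i`, read modulo `m`, is closed under addition, contains `e` and contains no
`i` with `0 < i < e`. -/
theorem dvd_of_forall_le_finrank_ker [Fintype K] [Fintype L] {m e : ℕ} (hm : finrank K L = m)
    (α β : (Fin m → K) →ₗ[K] L) (hα : Function.Injective α) (hβ : ¬ Function.Injective β)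
    (he : finrank K (LinearMap.ker β) = e)
    (hmin : ∀ y : L, ¬ Function.Injective (β - y • α) →
      e ≤ finrank K (LinearMap.ker (β - y • α))) :
    e ∣ m := by
  classical
  have hmpos : 0 < m := hm ▸ finrank_pos
  have : NeZero m := ⟨hmpos.ne'⟩
  have hepos : 0 < e := by
    rw [← he, Nat.pos_iff_ne_zero, Ne, Submodule.finrank_eq_zero, LinearMap.ker_eq_bot]
    exact hβ
  have hem : e ≤ m := by
    rw [← he]
    exact (Submodule.finrank_le _).trans (finrank_fin_fun K).le
  rcases hem.eq_or_lt with rfl | hem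
  · exact dvd_rfl
  set q := Fintype.card K with hqdef
  have hq : 1 < q := Fintype.one_lt_card
  have hQ : Fintype.card L = q ^ m := by rw [card_eq_pow_finrank (K := K), hm]
  have hVcard : Fintype.card (Fin m → K) = q ^ m := by simp [hqdef]
  have hcardker : ∀ f : (Fin m → K) →ₗ[K] L,
      Nat.card (LinearMap.ker f) = q ^ finrank K (LinearMap.ker f) := fun f => by
    rw [Nat.card_eq_fintype_card, card_eq_pow_finrank (K := K)]
  set c : ℕ → L[X] := fun i => (redei α β).coeff (q ^ i) with hc
  have hcm : c m = 1 := by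
    have := (redei_monic α β).coeff_natDegree
    rwa [natDegree_redei, hVcard] at this
  have hce : c e ≠ 0 := by
    have := coeff_redei_card_ker_ne_zero α β
    rwa [hcardker, he] at this
  have hc_zero : ∀ i, 0 < i → i < e → c i = 0 := by
    intro i hi hie
    refine coeff_redei_eq_zero (hVcard.trans hQ.symm) α β (Nat.one_lt_pow hi.ne' hq) ?_
      fun y hy => ?_
    · rw [hQ]
      exact Nat.pow_lt_pow_right hq (hie.trans hem)
    · rw [hcardker]
      exact Nat.pow_lt_pow_right hq (hie.trans_le (hmin y hy))
  -- Write the linear set as the graph of `f`, with coefficients `F`.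
  have hbij : Function.Bijective α := by
    refine (Fintype.bijective_iff_injective_and_card α).2 ⟨hα, ?_⟩
    rw [hVcard, hQ]
  let f : L →ₗ[K] L := β.comp (LinearEquiv.ofBijective α hbij).symm.toLinearMap
  obtain ⟨F, hF⟩ := exists_linearized_repr hm f
  have hβf : ∀ u, β u = f (α u) := fun u =>
    congrArg β ((LinearEquiv.ofBijective α hbij).symm_apply_apply u).symm
  have hcirc := circulant_system_of_linearized_relation hm F f hF c hcm fun x => by
    obtain ⟨u, rfl⟩ := hbij.2 x
    rw [← hβf]
    exact sum_coeff_redei_mul_eq_zero α β u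
  -- As `x ^ (q ^ m) = x`, the term of index `m` of the relation is absorbed in that of index `0`.
  set γ : ZMod m → L[X] := fun k => c k.val + if k = 0 then 1 else 0 with hγ
  have hsys : ∀ k, k ≠ 0 → γ k * X ^ q ^ k.val
      = ∑ i, C (F (k - i) ^ q ^ i.val) * γ i := by
    intro k hk
    rw [← hcirc k hk]
    simp only [hγ, if_neg hk, add_zero]
    rfl
  have hγ0 : γ 0 ≠ 0 := by
    intro h0
    have h1 := congrArg (eval 0) h0
    simp only [hγ, if_true, ZMod.val_zero, eval_add, eval_one, eval_zero] at h1
    have h2 : (c 0).eval 0 = 0 := by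
      refine eval_coeff_redei_of_lt_card_ker α β 0 ?_
      rw [zero_smul, sub_zero, hcardker, he]
      exact Nat.pow_lt_pow_right hq hepos
    rw [h2, zero_add] at h1
    exact one_ne_zero h1
  have hcast : ∀ i, 0 < i → i < m → γ (i : ZMod m) = c i := by
    intro i hi him
    have hv : (i : ZMod m).val = i := ZMod.val_cast_of_lt him
    have hne : (i : ZMod m) ≠ 0 := by
      intro hh
      rw [hh, ZMod.val_zero] at hv
      omega
    simp only [hγ, hv, if_neg hne, add_zero]
  -- The support of `γ` contains the multiples of `e`, hence `t e - m` for the least `t` for which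
  -- this is nonnegative; this number is less than `e`, so it vanishes.
  have hmul : ∀ t : ℕ, γ ((t * e : ℕ) : ZMod m) ≠ 0 := by
    intro t
    induction t with
    | zero => simpa using hγ0
    | succ t ih =>
      rw [Nat.succ_mul, Nat.cast_add]
      refine add_ne_zero_of_circulant_system hq γ
        (fun i k => F (k - i) ^ q ^ i.val) F (fun i k => ?_) hsys hγ0 _ _ ih ?_
      · rw [Ne, pow_eq_zero_iff (pow_ne_zero _ (by omega))]
      · rw [hcast e hepos hem]
        exact hce
  have hdm := Nat.div_add_mod m e
  by_contra hnd
  have hmod : 0 < m % e := Nat.pos_of_ne_zero fun h => hnd (Nat.dvd_of_mod_eq_zero h)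
  have hmod' := Nat.mod_lt m hepos
  refine hmul (m / e + 1) ?_
  have h1 : ((m / e + 1) * e) = m + (e - m % e) := by
    rw [add_mul, one_mul, mul_comm]
    omega
  rw [h1, Nat.cast_add, ZMod.natCast_self, zero_add, hcast _ (by omega) (by omega)]
  exact hc_zero _ (by omega) (by omega)

end MaximumRank

/-! ### Numerical consequences -/

section Arithmetic

/-- The numerical consequences of the two bounds on the number `G` of good points, with
`Q = q ^ m`. -/
lemma bounds_of_card_good {q m n e G : ℕ} (hq : 2 ≤ q) (hm : 1 ≤ m) (he : 1 ≤ e) (hen : e ≤ n)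
    (hup : G + q ^ (n - e) ≤ q ^ m)
    (hlow : (q ^ m - G + 1) * (q ^ e - 1) + 1 ≤ q ^ n) :
    ((q : ℝ) ^ (2 * m) - 1 - ((q : ℝ) ^ m - 1) * (((q : ℝ) ^ n - 1) / ((q : ℝ) ^ e - 1))
        ≤ (((q ^ m - 1) * G : ℕ) : ℝ)) ∧
    ((((q ^ m - 1) * G : ℕ) : ℝ)
        ≤ (q : ℝ) ^ (2 * m) - 1 - ((q : ℝ) ^ m - 1) * ((q : ℝ) ^ (n - e) + 1)) ∧
    ((n : ℤ) = ⌊Real.logb (q : ℝ)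
        ((q : ℝ) ^ m + 1 - (((q ^ m - 1) * G : ℕ) : ℝ) / ((q : ℝ) ^ m - 1))⌋ + (e : ℤ)) := by
  have hqR : (2 : ℝ) ≤ q := by exact_mod_cast hq
  have hQ1 : 1 < (q : ℝ) ^ m := one_lt_pow₀ (by linarith) (by omega)
  have hE1 : 1 < (q : ℝ) ^ e := one_lt_pow₀ (by linarith) (by omega)
  have hqE : (q : ℝ) ≤ (q : ℝ) ^ e := le_self_pow₀ (by linarith) (by omega)
  have hP0 : 0 < (q : ℝ) ^ (n - e) := by positivity
  have hPE : (q : ℝ) ^ (n - e) * (q : ℝ) ^ e = (q : ℝ) ^ n := by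
    rw [← pow_add, Nat.sub_add_cancel hen]
  have hM : (((q ^ m - 1) * G : ℕ) : ℝ) = ((q : ℝ) ^ m - 1) * G := by
    rw [Nat.cast_mul, Nat.cast_sub (Nat.one_le_pow _ _ (by omega))]
    push_cast
    ring
  have hupR : (G : ℝ) + (q : ℝ) ^ (n - e) ≤ (q : ℝ) ^ m := by exact_mod_cast hup
  have hlowR : ((q : ℝ) ^ m - G + 1) * ((q : ℝ) ^ e - 1) + 1 ≤ (q : ℝ) ^ n := by
    have h1 : G ≤ q ^ m := by omega
    have h2 : 1 ≤ q ^ e := Nat.one_le_pow _ _ (by omega)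
    have h3 : (((q ^ m - G + 1) * (q ^ e - 1) + 1 : ℕ) : ℝ) ≤ ((q ^ n : ℕ) : ℝ) := by
      exact_mod_cast hlow
    push_cast [Nat.cast_sub h1, Nat.cast_sub h2] at h3
    exact h3
  have hsq : (q : ℝ) ^ (2 * m) = (q : ℝ) ^ m * (q : ℝ) ^ m := by rw [two_mul, pow_add]
  rw [hM, hsq]
  set Q := (q : ℝ) ^ m
  set E := (q : ℝ) ^ e
  set P := (q : ℝ) ^ (n - e) with hPdef
  set N := (q : ℝ) ^ n
  refine ⟨?_, ?_, ?_⟩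
  · have h1 : Q - G + 1 ≤ (N - 1) / (E - 1) := by
      rw [le_div_iff₀ (by linarith)]
      linarith
    have h2 := mul_le_mul_of_nonneg_left h1 (by linarith : (0 : ℝ) ≤ Q - 1)
    linarith
  · have h2 := mul_le_mul_of_nonneg_left hupR (by linarith : (0 : ℝ) ≤ Q - 1)
    linarith
  · have hdiv : (Q - 1) * G / (Q - 1) = G := by
      rw [mul_div_assoc, mul_comm, div_mul_cancel₀]
      linarith
    rw [hdiv]
    have hfloor : ⌊Real.logb (q : ℝ) (Q + 1 - G)⌋ = ((n - e : ℕ) : ℤ) := by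
      have hq1 : (1 : ℝ) < q := by linarith
      have hx : 0 < Q + 1 - G := by linarith
      rw [Int.floor_eq_iff]
      constructor
      · rw [Real.le_logb_iff_rpow_le hq1 hx, Int.cast_natCast, Real.rpow_natCast]
        linarith
      · rw [Real.logb_lt_iff_lt_rpow hq1 hx, Int.cast_natCast, ← Nat.cast_succ, Real.rpow_natCast,
          Nat.succ_eq_add_one, pow_succ, ← hPdef]
        have h1 : (Q + 1 - G) * (E - 1) < P * q * (E - 1) := by
          have h2 : P * q ≤ N := by
            rw [← hPE]
            exact mul_le_mul_of_nonneg_left hqE hP0.le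
          have h3 : N * 1 ≤ N * (q - 1) :=
            mul_le_mul_of_nonneg_left (by linarith) (by positivity)
          have h4 : P * q * (E - 1) = N * q - P * q := by rw [← hPE]; ring
          rw [h4]
          linarith
        exact lt_of_mul_lt_mul_right h1 (by linarith)
    rw [hfloor]
    omega

end Arithmetic

/-! ### The weight distribution of a two-dimensional code -/

theorem mainTheorem5 {K L : Type*} [Field K] [Finite K] [Field L] [Finite L] [Algebra K L]
    (q m n e : ℕ) (hq : Nat.card K = q) (hm : Module.finrank K L = m)
    (C : Submodule L (Fin n → L)) (hdim : Module.finrank L C = 2)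
    (hC : IsNondegenerateCode K C) (hnm : n ≤ m)
    (hen : e ≤ n) (he : IsSecondMaxWeight K C (n - e)) :
    ((q : ℝ) ^ (2 * m) - 1 - ((q : ℝ) ^ m - 1) * (((q : ℝ) ^ n - 1) / ((q : ℝ) ^ e - 1))
        ≤ (numMaxWeight K C : ℝ)) ∧
    ((numMaxWeight K C : ℝ)
        ≤ (q : ℝ) ^ (2 * m) - 1 - ((q : ℝ) ^ m - 1) * ((q : ℝ) ^ (n - e) + 1)) ∧
    ((n : ℤ) = ⌊Real.logb (q : ℝ)
        ((q : ℝ) ^ m + 1 - (numMaxWeight K C : ℝ) / ((q : ℝ) ^ m - 1))⌋ + (e : ℤ)) ∧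
    (m = n → e ∣ m) := by
  classical
  have := Fintype.ofFinite K
  have := Fintype.ofFinite L
  have hqK : Fintype.card K = q := by rw [← Nat.card_eq_fintype_card, hq]
  have hq2 : 2 ≤ q := hqK ▸ Fintype.one_lt_card
  have hmpos : 1 ≤ m := hm ▸ Module.finrank_pos
  have hcardL : Nat.card L = q ^ m := by
    rw [Nat.card_eq_fintype_card, Module.card_eq_pow_finrank (K := K), hm, hqK]
  have hcardV : Nat.card (Fin n → K) = q ^ n := by
    rw [Nat.card_eq_fintype_card, Module.card_eq_pow_finrank (K := K), Module.finrank_fin_fun, hqK]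
  have hqpow : q ^ n ≤ q ^ m := Nat.pow_le_pow_right (by omega) hnm
  have hker : ∀ f : (Fin n → K) →ₗ[K] L,
      Nat.card (LinearMap.ker f) = q ^ Module.finrank K (LinearMap.ker f) := fun f => by
    rw [Nat.card_eq_fintype_card, Module.card_eq_pow_finrank (K := K), hqK]
  obtain ⟨wmax, ⟨⟨c₁, -, -, hc₁⟩, hwmax⟩, ⟨⟨b, hbC, hb0, hbw⟩, hbne⟩, hsecond⟩ := he
  have hwn : wmax ≤ n := by
    have := rankWeight_add_finrank_ker (K := K) c₁
    omega
  have hbn : n - e < wmax :=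
    lt_of_le_of_ne (hwmax ⟨b, hbC, hb0, hbw⟩) hbne
  have hepos : 1 ≤ e := by omega
  have hbker : Module.finrank K (LinearMap.ker (Fintype.linearCombination K b)) = e := by
    have := rankWeight_add_finrank_ker (K := K) b
    omega
  have hbinj : ¬ Function.Injective (Fintype.linearCombination K b) := by
    rw [← rankWeight_eq_iff_injective]
    omega
  obtain ⟨u, hu⟩ := exists_linearCombination_ne_zero (K := K) hb0
  have hblin : Fintype.linearCombination K b ≠ 0 := fun h => hu (by rw [h]; rfl)
  obtain ⟨a, haC, ha0, hau⟩ := exists_mem_linearCombination_eq_zero hdim u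
  have hab : LinearIndependent L ![a, b] := linearIndependent_pair_of_relation ha0 u hau hu
  have hainj : ¬ Function.Injective (Fintype.linearCombination K a) := fun h => by
    have : u = 0 := h (by rw [hau, map_zero])
    exact hu (by rw [this, map_zero])
  have hnd : ∀ v, Fintype.linearCombination K a v = 0 → Fintype.linearCombination K b v = 0 →
      v = 0 := hC.eq_zero hdim haC hbC hab
  have hline : ∀ y : L, b - y • a ∈ C ∧ b - y • a ≠ 0 := by
    refine fun y => ⟨C.sub_mem hbC (C.smul_mem _ haC), fun h => ?_⟩
    have h1 := LinearIndependent.pair_iff.1 hab (-y) 1 (by rw [← h]; module)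
    exact one_ne_zero h1.2
  -- The `q ^ m + 1` points cannot all have positive weight, so `n` is the maximum weight.
  obtain ⟨c, hcC, hcinj⟩ : ∃ c ∈ C, Function.Injective (Fintype.linearCombination K c) := by
    by_contra! hcon
    have htwo : ∀ f : (Fin n → K) →ₗ[K] L, ¬ Function.Injective f →
        1 + 1 ≤ Nat.card (LinearMap.ker f) := by
      intro f hf
      rw [hker]
      have : Module.finrank K (LinearMap.ker f) ≠ 0 := by
        rwa [Ne, Submodule.finrank_eq_zero, LinearMap.ker_eq_bot]
      exact hq2.trans (Nat.le_self_pow this q)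
    have h1 := card_points_mul_le _ _ hnd 1 (htwo _ hainj) fun y => htwo _
    have h2 : Nat.card {y : L // ¬ Function.Injective
        (Fintype.linearCombination K b - y • Fintype.linearCombination K a)} = q ^ m := by
      rw [← hcardL]
      refine Nat.card_congr (Equiv.subtypeUnivEquiv fun y => ?_)
      rw [← linearCombination_sub_smul_left]
      exact hcon _ (hline y).1
    rw [h2, hcardV] at h1
    omega
  have hc0 : c ≠ 0 := by
    rintro rfl
    exact hu (by rw [hcinj (a₁ := u) (a₂ := 0) (by simp [Fintype.linearCombination_apply]), map_zero])
  have hwmax_eq : wmax = n :=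
    le_antisymm hwn (hwmax ⟨c, hcC, hc0, (rankWeight_eq_iff_injective c).2 hcinj⟩)
  have hmin : ∀ d ∈ C, d ≠ 0 → ¬ Function.Injective (Fintype.linearCombination K d) →
      e ≤ Module.finrank K (LinearMap.ker (Fintype.linearCombination K d)) := by
    intro d hdC hd0 hd
    have h1 := rankWeight_add_finrank_ker (K := K) d
    have h2 : rankWeight K d ≠ wmax := by rwa [hwmax_eq, Ne, rankWeight_eq_iff_injective]
    have h3 := hsecond ⟨⟨d, hdC, hd0, rfl⟩, h2⟩
    omega
  set G := Nat.card {y : L // Function.Injective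
    (Fintype.linearCombination K b - y • Fintype.linearCombination K a)} with hG
  have hup : G + q ^ (n - e) ≤ q ^ m := by
    have h1 := card_injective_add_card_range_le (Fintype.linearCombination K a)
      (Fintype.linearCombination K b) hbinj hblin
    have h2 : Nat.card (Set.range (Fintype.linearCombination K b)) = q ^ (n - e) := by
      change Nat.card (LinearMap.range (Fintype.linearCombination K b)) = _
      rw [Nat.card_eq_fintype_card, Module.card_eq_pow_finrank (K := K), hqK,
        ← rankWeight_eq_finrank_range, hbw]
    rwa [h2, hcardL] at h1
  have hlow : (q ^ m - G + 1) * (q ^ e - 1) + 1 ≤ q ^ n := by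
    have hqe : q ^ e - 1 + 1 = q ^ e := Nat.sub_add_cancel (Nat.one_le_pow _ _ (by omega))
    have h1 := card_points_mul_le _ _ hnd (q ^ e - 1)
      (by
        rw [hqe, hker]
        exact Nat.pow_le_pow_right (by omega) (hmin a haC ha0 hainj))
      fun y hy => by
        rw [hqe, hker]
        rw [← linearCombination_sub_smul_left] at hy ⊢
        exact Nat.pow_le_pow_right (by omega) (hmin _ (hline y).1 (hline y).2 hy)
    have h2 : Nat.card {y : L // ¬ Function.Injective
        (Fintype.linearCombination K b - y • Fintype.linearCombination K a)} = q ^ m - G := by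
      rw [hG, ← hcardL, Nat.card_eq_fintype_card, Nat.card_eq_fintype_card,
        Nat.card_eq_fintype_card, Fintype.card_subtype_compl]
    rwa [h2, hcardV] at h1
  have hM : numMaxWeight K C = (q ^ m - 1) * G := by
    rw [numMaxWeight_eq hdim (by omega) haC hbC hab hainj, hcardL]
  rw [hM]
  obtain ⟨h1, h2, h3⟩ := bounds_of_card_good hq2 hmpos hepos hen hup hlow
  refine ⟨h1, h2, h3, ?_⟩
  rintro rfl
  -- Here the codeword `c` of maximum weight, rather than `a`, is the point at infinity.
  obtain ⟨v, hv, hv0⟩ : ∃ v, Fintype.linearCombination K b v = 0 ∧ v ≠ 0 := by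
    rw [injective_iff_map_eq_zero] at hbinj
    push Not at hbinj
    exact hbinj
  have hbc : LinearIndependent L ![b, c] := linearIndependent_pair_of_relation hb0 v hv
    fun h => hv0 (hcinj (by rw [h, map_zero]))
  refine dvd_of_forall_le_finrank_ker hm (Fintype.linearCombination K c)
    (Fintype.linearCombination K b) hcinj hbinj hbker fun y hy => ?_
  rw [← linearCombination_sub_smul_left] at hy ⊢
  refine hmin _ (C.sub_mem hbC (C.smul_mem _ hcC)) (fun h => ?_) hy
  have h4 := LinearIndependent.pair_iff.1 hbc 1 (-y) (by rw [← h]; module)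
  exact one_ne_zero h4.1
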